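/- **Setting.** Let $G=(V,E)$ be a finite directed acyclic graph and let $X=(X_v)_{v\in V}$ be a random vector with law $P$ having a density $P(x)$ with respect to a product of $\sigma$-finite reference measures $\mu_v$ on the spaces of values of the $X_v$. (For discrete variables the $\mu_v$ are counting measures and densities are probability mass functions.) All marginals below are obtained by integrating (summing) the density over the remaining coordinates. For each node $k$ with parent set $pa(k)$ let $P(x_k\mid x_{pa(k)})$ be a conditional density of $X_k$ given $X_{pa(k)}$: jointly measurable, integrating to $1$ in $x_k$ for every value of $x_{pa(k)}$, and satisfying $P(x_k\mid x_{pa(k)})\,P(x_{pa(k)})=P(x_k,x_{pa(k)})$. The graph $G$ is an *info-causal DAG* for $X$ if $P(x)=\prod_{k\in V}P(x_k\mid x_{pa(k)})$ and, for each $A\subseteq V$ and each value $\tilde x_A$, the info-intervention distribution has the density $$P(x\mid\sigma(\tilde x_A))=\prod_{k\in V}P(x_k\mid x^*_{pa(k)}),\qquad x^*_j=\tilde x_j \text{ if } j\in A,\quad x^*_j=x_j\text{ if } j\notin A .$$ Write $P(x_B\mid\sigma(\tilde x_A))$ for its marginals and $P(x_B\mid\sigma(\tilde x_A),x_C)=P(x_B,x_C\mid\sigma(\tilde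 x_A))/P(x_C\mid\sigma(\tilde x_A))$, which is *defined* when the denominator is neither $0$ nor $\infty$. For disjoint $A$ and $C$, intervening by both $\sigma(\tilde x_A)$ and $\sigma(\tilde x_C)$ means intervening by $\sigma(\tilde x_A,\tilde x_C)$, i.e. by $\sigma(\tilde x_{A\cup C})$. Let $G^{\sigma(\tilde x_A)}$ be $G$ with all arrows out of nodes of $A$ removed, let $H_{\overline I}$ be a graph $H$ with all arrows into nodes of $I$ removed, and let $anc(D)$ be the set of ancestors of nodes of $D$. In a directed graph, $B\perp_d C\mid D$ means that every path (sequence of distinct nodes, consecutive ones joined by an arrow in either direction) from a node of $B$ to a node of $C$ is blocked by $D$: it has an interior node that is either a collider with neither itself nor any of its descendants in $D$, or a non-collider lying in $D$. **Theorem (Three rules for info intervention).** Let $G$ be an info-causal DAG for $X$ and let $A,B,C,D$ be arbitrary pairwise disjoint sets of nodes. The following equalities hold for all values $\tilde x_A,\tilde x_C,x_B,x_C,x_D$ for which both sides are defined. * **Rule 1** (insertion/deletion of observations). If $B\perp_d C\mid D$ in $G^{\sigma(\tilde x_A)}$, then $$P(x_B\mid\sigma(\tilde x_A),x_C,x_D)=P(x_B\mid\sigma(\tilde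 x_A),x_D).$$ * **Rule 2** (action/observation exchange). If $B\perp_d C\mid D$ in $G^{\sigma(\tilde x_A,\tilde x_C)}$, then $$P(x_B\mid\sigma(\tilde x_A),\sigma(\tilde x_C),x_D)=P(x_B\mid\sigma(\tilde x_A),\tilde x_C,x_D).$$ * **Rule 3** (insertion/deletion of actions). If $B\perp_d C\mid D$ in $G^{\sigma(\tilde x_A)}_{\overline{C\setminus anc(D)}}$, then $$P(x_B\mid\sigma(\tilde x_A),\sigma(\tilde x_C),x_D)=P(x_B\mid\sigma(\tilde x_A),x_D).$$ This holds with $anc(D)$ taken in $G$, and also with $anc(D)$ taken in $G^{\sigma(\tilde x_A)}$. -/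

import Mathlib

open MeasureTheory
open scoped ENNReal

noncomputable section

namespace InfoCalculus

/-! ### Directed graphs -/

section Graph

variable {V : Type*}

/-- A directed graph without directed cycles. -/
def IsDAG (G : Digraph V) : Prop :=
  ∀ v, ¬ Relation.TransGen G.Adj v v

/-- `G` with all arrows out of nodes of `A` removed; this is the graph of the info-intervention
DAG for an intervention on the nodes `A`. -/
def removeOutgoing (G : Digraph V) (A : Set V) : Digraph V where
  Adj i j := G.Adj i j ∧ i ∉ A

/-- `G` with all arrows into nodes of `I` removed. -/
def removeIncoming (G : Digraph V) (I : Set V) : Digraph V where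
  Adj i j := G.Adj i j ∧ j ∉ I

/-- The nodes of `G` that are an ancestor of some node of `D`. -/
def anc (G : Digraph V) (D : Set V) : Set V :=
  {v | ∃ d ∈ D, Relation.TransGen G.Adj v d}

/-- A path of `G`: a nonempty list of distinct nodes, any two consecutive ones being joined by an
arrow in one direction or the other. -/
def IsPath (G : Digraph V) (p : List V) : Prop :=
  p ≠ [] ∧ p.Nodup ∧ p.IsChain (fun i j => G.Adj i j ∨ G.Adj j i)

/-- The middle one of three consecutive nodes `l, m, r` of a path is a collider on that path. -/
def IsCollider (G : Digraph V) (l m r : V) : Prop :=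
  G.Adj l m ∧ G.Adj r m

/-- The path `p` is not blocked by `D`: each collider on it is in `D` or has a descendant in `D`,
and none of its other interior nodes is in `D`. -/
def IsUnblocked (G : Digraph V) (D : Set V) (p : List V) : Prop :=
  ∀ l m r, [l, m, r] <:+: p →
    (IsCollider G l m r → m ∈ D ∨ m ∈ anc G D) ∧ (¬ IsCollider G l m r → m ∉ D)

/-- `d`-separation of `B` and `C` by `D` in `G` (for disjoint `B`, `C`, `D`): every path from a
node of `B` to a node of `C` is blocked by `D`. -/
def DSep (G : Digraph V) (B C D : Set V) : Prop :=
  ∀ p : List V, IsPath G p → (∃ b ∈ B, p.head? = some b) → (∃ c ∈ C, p.getLast? = some c) →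
    ¬ IsUnblocked G D p

open Classical in
/-- The parents of the node `k`. -/
def parents [Fintype V] (G : Digraph V) (k : V) : Finset V :=
  Finset.univ.filter fun j => G.Adj j k

end Graph

/-! ### Info-causal DAGs -/

section Model

variable {V : Type*} [Fintype V] [DecidableEq V] {𝒳 : V → Type*} [∀ v, MeasurableSpace (𝒳 v)]

/-- The marginal density at the coordinates `x_B` of a density `f` with respect to the product of
the reference measures `μ v`: all the coordinates outside `B` are integrated out (summed over, when
the `μ v` are counting measures). The value depends only on the coordinates of `x` in `B`. -/
def marginal (μ : ∀ v, Measure (𝒳 v)) (f : (∀ v, 𝒳 v) → ℝ≥0∞) (B : Finset V)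
    (x : ∀ v, 𝒳 v) : ℝ≥0∞ :=
  lmarginal μ Bᶜ f x

/-- For discrete variables, the marginals of a density with respect to the counting measures are the
point probabilities `P(X_B = x_B)`. -/
theorem withDensity_count_cylinder [∀ v, Countable (𝒳 v)] [∀ v, MeasurableSingletonClass (𝒳 v)]
    (f : (∀ v, 𝒳 v) → ℝ≥0∞) (hf : Measurable f) (B : Finset V) (x : ∀ v, 𝒳 v) :
    ((Measure.pi fun v => (Measure.count : Measure (𝒳 v))).withDensity f)
      {y | ∀ b ∈ B, y b = x b} = marginal (fun _ => Measure.count) f B x := by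
  have hS : MeasurableSet {y : ∀ v, 𝒳 v | ∀ b ∈ B, y b = x b} := Set.Countable.measurableSet (Set.to_countable _)
  rw [withDensity_apply _ hS, ← lintegral_indicator hS, lintegral_eq_lmarginal_univ x,
    ← Finset.union_compl B, lmarginal_union _ _ (hf.indicator hS) disjoint_compl_right]
  have h1 : ∀ y : ∀ b : B, 𝒳 b, lmarginal (fun v => (Measure.count : Measure (𝒳 v))) Bᶜ
      ({y | ∀ b ∈ B, y b = x b}.indicator f) (Function.updateFinset x B y) =
      Set.indicator {fun b : B => x b}
        (fun _ => lmarginal (fun v => (Measure.count : Measure (𝒳 v))) Bᶜ f x) y := by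
    intro y
    by_cases hy : y = fun b : B => x b
    · subst hy
      have h0 : Function.updateFinset x B (fun b : B => x b) = x := by
        ext v; simp [Function.updateFinset]
      rw [h0, Set.indicator_of_mem (Set.mem_singleton _)]
      refine lintegral_congr fun z => Set.indicator_of_mem ?_ _
      intro b hb
      simp [Function.updateFinset, hb]
    · rw [Set.indicator_of_notMem (by simpa using hy)]
      have : ∀ z, ({y | ∀ b ∈ B, y b = x b}.indicator f)
          (Function.updateFinset (Function.updateFinset x B y) Bᶜ z) = 0 := by
        intro z
        refine Set.indicator_of_notMem (fun h => hy ?_) _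
        ext b
        simpa [Function.updateFinset, b.2] using h b b.2
      simp [lmarginal, this]
  rw [lmarginal]
  simp_rw [h1]
  rw [lintegral_indicator (measurableSet_singleton _), setLIntegral_const, Measure.pi_singleton]
  simp [marginal]

/-- `InfoCausalDAG G μ P`: the directed graph `G` is an info-causal DAG for a random vector with law
`P`. `density` is the density `P(x)` (the probability mass function, when the `μ v` are counting
measures), and `cond k x_{pa(k)} x_k` is the conditional density `P(x_k | x_{pa(k)})`. The family of
info-intervention distributions that goes with it is `infoDensity` below. -/
structure InfoCausalDAG (G : Digraph V) (μ : ∀ v, Measure (𝒳 v)) [∀ v, SigmaFinite (μ v)]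
    (P : Measure (∀ v, 𝒳 v)) where
  isDAG : IsDAG G
  density : (∀ v, 𝒳 v) → ℝ≥0∞
  measurable_density : Measurable density
  law_eq : P = (Measure.pi μ).withDensity density
  cond : ∀ k, (∀ j : parents G k, 𝒳 j) → 𝒳 k → ℝ≥0∞
  measurable_cond : ∀ k, Measurable fun q : (∀ j : parents G k, 𝒳 j) × 𝒳 k => cond k q.1 q.2
  /-- Each `cond k y` is a probability density. -/
  lintegral_cond : ∀ k y, ∫⁻ t, cond k y t ∂(μ k) = 1
  /-- `P(x_k | x_{pa(k)}) P(x_{pa(k)}) = P(x_k, x_{pa(k)})`. -/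
  cond_mul_marginal : ∀ k x, cond k (fun j => x j) (x k) * marginal μ density (parents G k) x =
    marginal μ density (insert k (parents G k)) x
  /-- `P` factorizes according to `G`. -/
  factorizes : ∀ x, density x = ∏ k, cond k (fun j => x j) (x k)

namespace InfoCausalDAG

variable {G : Digraph V} {μ : ∀ v, Measure (𝒳 v)} [∀ v, SigmaFinite (μ v)]
  {P : Measure (∀ v, 𝒳 v)}

/-- The density `P(x | σ(x̃_A)) = ∏ k, P(x_k | x*_{pa(k)})` of the info-intervention distribution,
where `x*_j = x̃_j` for `j ∈ A` and `x*_j = x_j` otherwise. -/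
def infoDensity (M : InfoCausalDAG G μ P) (A : Finset V) (x' : ∀ v, 𝒳 v) (x : ∀ v, 𝒳 v) : ℝ≥0∞ :=
  ∏ k, M.cond k (fun j => A.piecewise x' x j) (x k)

/-- The info-intervention distribution: the law of `X^{σ(x̃_A)}`. -/
def infoLaw (M : InfoCausalDAG G μ P) (A : Finset V) (x' : ∀ v, 𝒳 v) : Measure (∀ v, 𝒳 v) :=
  (Measure.pi μ).withDensity (M.infoDensity A x')

/-- `P(x_B | σ(x̃_A))`. -/
def infoProb (M : InfoCausalDAG G μ P) (A : Finset V) (x' : ∀ v, 𝒳 v) (B : Finset V)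
    (x : ∀ v, 𝒳 v) : ℝ≥0∞ :=
  marginal μ (M.infoDensity A x') B x

/-- For discrete variables, `P(x_B | σ(x̃_A)) = P(X_B^{σ(x̃_A)} = x_B)`. -/
theorem infoProb_eq_infoLaw [∀ v, Countable (𝒳 v)] [∀ v, MeasurableSingletonClass (𝒳 v)]
    {P : Measure (∀ v, 𝒳 v)}
    (M : InfoCausalDAG G (fun v => (Measure.count : Measure (𝒳 v))) P) (A : Finset V)
    (x' : ∀ v, 𝒳 v) (B : Finset V) (x : ∀ v, 𝒳 v) :
    M.infoProb A x' B x = M.infoLaw A x' {y | ∀ b ∈ B, y b = x b} :=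
  (withDensity_count_cylinder _ (measurable_of_countable _) B x).symm

/-- `P(x_B | σ(x̃_A), x_C) = P(x_B, x_C | σ(x̃_A)) / P(x_C | σ(x̃_A))`; meaningful under
`InfoCondDefined` only. -/
def infoCond (M : InfoCausalDAG G μ P) (A : Finset V) (x' : ∀ v, 𝒳 v) (B C : Finset V)
    (x : ∀ v, 𝒳 v) : ℝ≥0∞ :=
  M.infoProb A x' (B ∪ C) x / M.infoProb A x' C x

/-- The quotient `P(x_B | σ(x̃_A), x_C)` is defined: its denominator `P(x_C | σ(x̃_A))` is neither
zero nor infinite (the latter cannot occur for probability mass functions). -/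
def InfoCondDefined (M : InfoCausalDAG G μ P) (A : Finset V) (x' : ∀ v, 𝒳 v) (C : Finset V)
    (x : ∀ v, 𝒳 v) : Prop :=
  M.infoProb A x' C x ≠ 0 ∧ M.infoProb A x' C x ≠ ∞

end InfoCausalDAG

end Model

end InfoCalculus

end

/-!
Each rule compares conditional densities of a density that factorizes as a product of conditional
densities `q k` of the variables given their parents in a DAG `H`; for the info-intervention on
`A`, the graph `H` is `G` without the arrows out of `A`.

The graphical part is the passage from paths to a separating set. Let `Z` be the ancestral closure
of `B ∪ C ∪ D`, and let `R` be the set of nodes of `Z` outside `D` from which some path to `C` is not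
blocked by `D`. If `D` d-separates `B` and `C`, then `R` avoids `B`, and `R ∪ D` contains every family
(a node of `Z` with its parents) that meets `R` (`DSep.exists_separating`). Paths must have distinct
nodes, so a path that is extended to a node already on it is cut at that node instead;
`ActiveTo.child` and `OpenTo.parent` show that the cut path serves as well.

The variables outside `Z` integrate out, children first (`IsMarkovFamily.lmarginal_compl`), and the
remaining product splits into the factors whose families avoid `R` and the others. These two parts
have only variables in `D` in common, so that by Tonelli each marginal of a set containing `D` is a
product of two integrals (`IsMarkovFamily.marginal_eq_mul`). In a conditional density of `x_B` the
integral of the second part cancels, and what remains does not depend on whether one conditions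
on `C` (`IsMarkovFamily.cond_eq`). All of this holds at every point at which the denominators are
neither zero nor infinite, not only almost everywhere.

The first rule is this statement. The second one is the first rule for the intervention on `A ∪ C`,
at the point whose coordinates in `C` are the intervened values: there both interventions have the
same marginals (`InfoCausalDAG.infoProb_union_eq`). For the third rule, `Z` is the ancestral closure
of `B ∪ D`, and `C ∩ Z` replaces `C` in the definition of `R`. All nodes of `C ∩ Z` are ancestors of `D`, so the removed
arrows do not end in `Z`, and the additional intervention on `C` changes only factors of the part
that cancels (`IsMarkovFamily.cond_congr_of_dSep`).
-/

/-! ### Active paths and d-separation -/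

namespace InfoCalculus

section ActivePaths

variable {V : Type*} {G : Digraph V} {C D : Set V}

/-- A path ending in `C` that is not blocked by `D`. It is read from its first node, so that it can
be extended by prepending nodes. -/
def IsActive (G : Digraph V) (C D : Set V) (p : List V) : Prop :=
  p.Nodup ∧ p.IsChain (fun i j => G.Adj i j ∨ G.Adj j i) ∧ IsUnblocked G D p ∧
    ∃ c ∈ C, p.getLast? = some c

/-- There is an active path from `w` to `C`. -/
def ActiveTo (G : Digraph V) (C D : Set V) (w : V) : Prop :=
  ∃ q, IsActive G C D (w :: q)

/-- There is an active path from `w` to `C` that stays active at `w` when it is extended by an arrow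
into `w`: if it leaves `w` through an outgoing arrow, `w` is a non-collider of the extension and
must not be in `D`; if it leaves through an incoming arrow, `w` is a collider of the extension
and must be in `D` or an ancestor of `D`. -/
def OpenTo (G : Digraph V) (C D : Set V) (w : V) : Prop :=
  ∃ q, IsActive G C D (w :: q) ∧ ∀ y ∈ q.head?,
    (G.Adj w y ∧ w ∉ D) ∨ (G.Adj y w ∧ (w ∈ D ∨ w ∈ anc G D))

theorem OpenTo.activeTo {w : V} (h : OpenTo G C D w) : ActiveTo G C D w :=
  let ⟨q, hq, _⟩ := h; ⟨q, hq⟩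

theorem IsDAG.asymm (hG : IsDAG G) {v w : V} (h : G.Adj v w) (h' : G.Adj w v) : False :=
  hG v (.tail (.single h) h')

theorem IsDAG.ne (hG : IsDAG G) {v w : V} (h : G.Adj v w) : v ≠ w := by
  rintro rfl; exact hG.asymm h h

theorem mem_anc_of_adj {v w : V} (h : G.Adj v w) (hw : w ∈ D ∨ w ∈ anc G D) : v ∈ anc G D := by
  rcases hw with hw | ⟨d, hd, hwd⟩
  · exact ⟨w, hw, .single h⟩
  · exact ⟨d, hd, .head h hwd⟩

theorem openTo_of_mem {c : V} (hc : c ∈ C) : OpenTo G C D c := by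
  refine ⟨[], ⟨by simp, by simp, ?_, c, hc, rfl⟩, by simp⟩
  intro l m r h
  have := h.length_le
  simp at this

theorem IsActive.of_suffix {s q : List V} {w : V} (h : IsActive G C D (s ++ w :: q)) :
    IsActive G C D (w :: q) := by
  obtain ⟨hn, hc, hu, c, hcC, hl⟩ := h
  have hs : w :: q <:+ s ++ w :: q := List.suffix_append _ _
  refine ⟨hn.sublist hs.sublist, hc.suffix hs, fun l m r h => hu l m r (h.trans hs.isInfix), c,
    hcC, ?_⟩
  simpa [List.getLast?_append, List.getLast?_cons] using hl

theorem IsActive.cons {w z : V} {q : List V} (h : IsActive G C D (z :: q)) (hw : w ∉ z :: q)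
    (hadj : G.Adj w z ∨ G.Adj z w)
    (htr : ∀ y ∈ q.head?, (IsCollider G w z y → z ∈ D ∨ z ∈ anc G D) ∧
      (¬ IsCollider G w z y → z ∉ D)) : IsActive G C D (w :: z :: q) := by
  obtain ⟨hn, hc, hu, c, hcC, hl⟩ := h
  refine ⟨List.nodup_cons.2 ⟨hw, hn⟩, List.isChain_cons_cons.2 ⟨hadj, hc⟩, ?_, c, hcC,
    by simpa using hl⟩
  intro l m r h
  rcases List.infix_cons_iff.1 h with h | h
  · obtain ⟨t, ht⟩ := h
    simp only [List.cons_append, List.nil_append, List.cons.injEq] at ht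
    obtain ⟨rfl, rfl, rfl⟩ := ht
    exact htr r (by simp)
  · exact hu l m r h

/-- Active paths extend backwards along an outgoing arrow of a node outside `D`. If the new node is
already on the path, the path is cut there. -/
theorem ActiveTo.child (hG : IsDAG G) {z w : V} (hz : ActiveTo G C D z) (hzD : z ∉ D)
    (h : G.Adj z w) : ActiveTo G C D w := by
  obtain ⟨q, hq⟩ := hz
  by_cases hw : w ∈ z :: q
  · obtain ⟨s, t, hst⟩ := List.append_of_mem hw
    rw [hst] at hq
    exact ⟨t, hq.of_suffix⟩
  · refine ⟨z :: q, hq.cons hw (.inr h) fun y _ => ⟨fun hc => (hG.asymm h hc.1).elim, fun _ => hzD⟩⟩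

/-- An extension along an arrow into a node of `D` is open there, since that node is a collider of
every further extension. -/
theorem ActiveTo.openTo_child (hG : IsDAG G) {z w : V} (hz : ActiveTo G C D z) (hzD : z ∉ D)
    (h : G.Adj z w) (hw : w ∈ D) : OpenTo G C D w := by
  obtain ⟨q, hq⟩ := hz
  by_cases hwq : w ∈ q
  · obtain ⟨s, t, rfl⟩ := List.append_of_mem hwq
    refine ⟨t, IsActive.of_suffix (s := z :: s) hq, fun y hy => .inr ⟨?_, .inl hw⟩⟩
    -- `w` is an interior node of an active path and in `D`, hence a collider of that path
    obtain ⟨t, rfl⟩ : ∃ t', t = y :: t' := by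
      cases t with
      | nil => simp at hy
      | cons a t => exact ⟨t, by simp at hy; rw [hy]⟩
    obtain ⟨s', l, hs⟩ : ∃ s' l, z :: s = s' ++ [l] :=
      ⟨_, _, (List.dropLast_append_getLast (List.cons_ne_nil z s)).symm⟩
    have := hq.2.2.1 l w y ⟨s', t, by rw [← List.cons_append, hs]; simp⟩
    by_contra hc
    exact this.2 (fun h' => hc h'.2) hw
  · have hwz : w ∉ z :: q := by
      simp only [List.mem_cons, not_or]; exact ⟨(hG.ne h).symm, hwq⟩
    refine ⟨z :: q, hq.cons hwz (.inr h)
      fun y _ => ⟨fun hc => (hG.asymm h hc.1).elim, fun _ => hzD⟩, fun y hy => .inr ⟨?_, .inl hw⟩⟩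
    simp at hy; rwa [← hy]

/-- On an active path from `z`, a node entered against an arrow is an ancestor of `D`, provided that
`z` is one whenever the path leaves `z` against an arrow: following the arrows back towards `z`
leads to a collider or to `z`. -/
theorem IsActive.mem_anc {z l w : V} {s q t : List V} (hq : IsActive G C D (z :: q))
    (hz : ∀ y ∈ q.head?, G.Adj y z → z ∈ D ∨ z ∈ anc G D) (hs : z :: q = s ++ l :: w :: t)
    (h : G.Adj w l) : w ∈ anc G D := by
  induction s using List.reverseRecOn generalizing l w t with
  | nil =>
    simp only [List.nil_append, List.cons.injEq] at hs
    obtain ⟨rfl, rfl⟩ := hs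
    exact mem_anc_of_adj h (hz w (by simp) h)
  | append_singleton s a ih =>
    simp only [List.append_assoc, List.cons_append, List.nil_append] at hs
    have hi : [a, l, w] <:+: z :: q := ⟨s, t, by rw [hs]; simp⟩
    have hal : G.Adj a l ∨ G.Adj l a := by
      have := hq.2.1.infix (l₁ := [a, l]) ⟨s, w :: t, by rw [hs]; simp⟩
      simpa using this
    rcases hal with hal | hal
    · exact mem_anc_of_adj h ((hq.2.2.1 a l w hi).1 ⟨hal, h⟩)
    · exact mem_anc_of_adj h (.inr (ih hs hal))

/-- Open paths extend backwards along an incoming arrow. If the new node is already on the path,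
the path is cut there and is still open. -/
theorem OpenTo.parent (hG : IsDAG G) {z w : V} (hz : OpenTo G C D z) (h : G.Adj w z)
    (hw : w ∉ D) : OpenTo G C D w := by
  obtain ⟨q, hq, hy⟩ := hz
  by_cases hwq : w ∈ q
  · obtain ⟨s, t, rfl⟩ := List.append_of_mem hwq
    refine ⟨t, IsActive.of_suffix (s := z :: s) hq, fun y hyt => ?_⟩
    obtain ⟨t, rfl⟩ : ∃ t', t = y :: t' := by
      cases t with
      | nil => simp at hyt
      | cons a t => exact ⟨t, by simp at hyt; rw [hyt]⟩
    obtain ⟨s', l, hs⟩ : ∃ s' l, z :: s = s' ++ [l] :=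
      ⟨_, _, (List.dropLast_append_getLast (List.cons_ne_nil z s)).symm⟩
    have hlist : z :: (s ++ w :: y :: t) = s' ++ l :: w :: y :: t := by
      rw [← List.cons_append, hs]; simp
    have hlw : G.Adj l w ∨ G.Adj w l := by
      have := hq.2.1.infix (l₁ := [l, w]) ⟨s', y :: t, by rw [hlist]; simp⟩
      simpa using this
    have hwy : G.Adj w y ∨ G.Adj y w := by
      have := hq.2.1.infix (l₁ := [w, y]) ⟨z :: s, t, by simp⟩
      simpa using this
    rcases hwy with hwy | hwy
    · exact .inl ⟨hwy, hw⟩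
    · refine .inr ⟨hwy, ?_⟩
      rcases hlw with hlw | hlw
      · exact (hq.2.2.1 l w y ⟨s', t, by rw [hlist]; simp⟩).1 ⟨hlw, hwy⟩
      · refine .inr (hq.mem_anc (fun y hy' hyz => ?_) hlist hlw)
        rcases hy y hy' with ⟨h1, -⟩ | ⟨-, h1⟩
        · exact (hG.asymm h1 hyz).elim
        · exact h1
  · have hwz : w ∉ z :: q := by
      simp only [List.mem_cons, not_or]; exact ⟨hG.ne h, hwq⟩
    refine ⟨z :: q, hq.cons hwz (.inl h) fun y hyq => ?_, fun y hy' => .inl ⟨?_, hw⟩⟩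
    · rcases hy y hyq with ⟨h1, h2⟩ | ⟨h1, h2⟩
      · exact ⟨fun hc => (hG.asymm h1 hc.2).elim, fun _ => h2⟩
      · exact ⟨fun _ => h2, fun hc => (hc ⟨h, h1⟩).elim⟩
    · simp at hy'; rwa [← hy']

/-- A directed path to `C` that starts outside `D` and its ancestors is active. -/
theorem openTo_of_mem_anc (hG : IsDAG G) {z : V} (hz : z ∈ C ∨ z ∈ anc G C)
    (hzD : z ∉ D) (hzA : z ∉ anc G D) : OpenTo G C D z := by
  rcases hz with hz | ⟨c, hc, hzc⟩
  · exact openTo_of_mem hz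
  · induction hzc using Relation.TransGen.head_induction_on with
    | single h => exact (openTo_of_mem hc).parent hG h hzD
    | head h _ ih =>
      exact (ih (fun hd => hzA (mem_anc_of_adj h (.inl hd)))
        (fun hd => hzA (mem_anc_of_adj h (.inr hd)))).parent hG h hzD

/-- An active path from a node outside `D` and its ancestors extends to all descendants of that
node. -/
theorem ActiveTo.descendant (hG : IsDAG G) {z b : V} (hzb : Relation.TransGen G.Adj z b)
    (hz : ActiveTo G C D z) (hzD : z ∉ D) (hzA : z ∉ anc G D) : ActiveTo G C D b := by
  induction hzb using Relation.TransGen.head_induction_on with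
  | single h => exact hz.child hG hzD h
  | head h _ ih =>
    exact ih (hz.child hG hzD h) (fun hd => hzA (mem_anc_of_adj h (.inl hd)))
      (fun hd => hzA (mem_anc_of_adj h (.inr hd)))

variable {B : Set V}

theorem DSep.not_activeTo (h : DSep G B C D) {b : V} (hb : b ∈ B) : ¬ ActiveTo G C D b := by
  rintro ⟨q, hn, hc, hu, hl⟩
  exact h (b :: q) ⟨by simp, hn, hc⟩ ⟨b, hb, rfl⟩ hl hu

/-- Within the ancestral closure of `B ∪ C ∪ D`, every active path to `C` is open, because there is
no active path from `B` to `C`. -/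
theorem DSep.openTo (hG : IsDAG G) (h : DSep G B C D) {z : V}
    (hz : z ∈ B ∪ C ∪ D ∨ z ∈ anc G (B ∪ C ∪ D)) (hzD : z ∉ D) (hzC : ActiveTo G C D z) :
    OpenTo G C D z := by
  by_cases hA : z ∈ anc G D
  · obtain ⟨q, hq⟩ := hzC
    refine ⟨q, hq, fun y hy => ?_⟩
    have : G.Adj z y ∨ G.Adj y z := by
      cases q with
      | nil => simp at hy
      | cons a q =>
        simp at hy
        subst hy
        exact (List.isChain_cons_cons.1 hq.2.1).1
    exact this.imp (⟨·, hzD⟩) (⟨·, .inr hA⟩)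
  · rcases hz with (hz | hz) | ⟨d, (hd | hd) | hd, hzd⟩
    · rcases hz with hz | hz
      · exact (h.not_activeTo hz hzC).elim
      · exact openTo_of_mem hz
    · exact (hzD hz).elim
    · exact (h.not_activeTo hd (hzC.descendant hG hzd hzD hA)).elim
    · exact openTo_of_mem_anc hG (.inr ⟨d, hd, hzd⟩) hzD hA
    · exact (hA ⟨d, hd, hzd⟩).elim

/-- Within the ancestral closure of `B ∪ C ∪ D`, having an active path to `C` passes between the
members of a family (a node with its parents) that are outside `D`. -/
theorem DSep.activeTo_of_family (hG : IsDAG G) (h : DSep G B C D) {k z w : V}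
    (hk : k ∈ B ∪ C ∪ D ∨ k ∈ anc G (B ∪ C ∪ D)) (hz : z = k ∨ G.Adj z k)
    (hw : w = k ∨ G.Adj w k) (hzD : z ∉ D) (hwD : w ∉ D) (hzC : ActiveTo G C D z) :
    ActiveTo G C D w := by
  have hkU : (k ∈ D → OpenTo G C D k) → ActiveTo G C D k → ActiveTo G C D w := by
    intro h1 h2
    rcases hw with rfl | hw
    · exact h2
    · have : OpenTo G C D k := by
        by_cases hkD : k ∈ D
        · exact h1 hkD
        · exact h.openTo hG hk hkD h2
      exact (this.parent hG hw hwD).activeTo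
  rcases hz with rfl | hz
  · exact hkU (fun h' => (hzD h').elim) hzC
  · exact hkU (hzC.openTo_child hG hzD hz) (hzC.child hG hzD hz)

end ActivePaths

/-! ### Removing arrows -/

section Subgraph

variable {V : Type*} {G : Digraph V} {B C D : Set V}

theorem IsDAG.mono {H : Digraph V} (hG : IsDAG G) (hle : ∀ i j, H.Adj i j → G.Adj i j) :
    IsDAG H :=
  fun v hv => hG v (Relation.TransGen.mono hle _ _ hv)

theorem anc_mono {H : Digraph V} (hle : ∀ i j, H.Adj i j → G.Adj i j) : anc H D ⊆ anc G D :=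
  fun _ ⟨d, hd, h⟩ => ⟨d, hd, Relation.TransGen.mono hle _ _ h⟩

/-- d-separation is inherited by subgraphs. -/
theorem DSep.mono {H : Digraph V} (hG : IsDAG G) (hle : ∀ i j, H.Adj i j → G.Adj i j)
    (h : DSep G B C D) : DSep H B C D := by
  rintro p ⟨hp, hn, hc⟩ hB hC hu
  refine h p ⟨hp, hn, hc.imp fun i j => Or.imp (hle i j) (hle j i)⟩ hB hC fun l m r hi => ?_
  have hlm : H.Adj l m ∨ H.Adj m l := by
    simpa using hc.infix (l₁ := [l, m]) (.trans ⟨[], [r], rfl⟩ hi)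
  have hmr : H.Adj m r ∨ H.Adj r m := by
    simpa using hc.infix (l₁ := [m, r]) (.trans ⟨[l], [], rfl⟩ hi)
  -- acyclicity of `G` prevents a non-collider of `H` from becoming a collider of `G`
  have hcol : IsCollider G l m r ↔ IsCollider H l m r := by
    refine ⟨fun hG' => ⟨?_, ?_⟩, fun hH => ⟨hle _ _ hH.1, hle _ _ hH.2⟩⟩
    · exact hlm.resolve_right fun h' => hG.asymm hG'.1 (hle _ _ h')
    · exact hmr.resolve_left fun h' => hG.asymm hG'.2 (hle _ _ h')
  rw [hcol]
  exact ⟨fun h' => ((hu l m r hi).1 h').imp_right fun h' => anc_mono hle h', (hu l m r hi).2⟩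

/-- Under the separation hypothesis of the third rule, the nodes of `C` that are no ancestors of `D`
lie outside the ancestral closure of `B ∪ D`: along a directed path from such a node to `B`, the
part after its last node in `C` would be active. -/
theorem DSep.notMem_ancestral (hG : IsDAG G)
    (h : DSep (removeIncoming G (C \ anc G D)) B C D) (hBC : Disjoint B C) (hCD : Disjoint C D)
    {c : V} (hc : c ∈ C \ anc G D) : ¬ (c ∈ B ∪ D ∨ c ∈ anc G (B ∪ D)) := by
  have hK : IsDAG (removeIncoming G (C \ anc G D)) := hG.mono fun _ _ h => h.1
  have key : ∀ z b, Relation.TransGen G.Adj z b →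
      ActiveTo (removeIncoming G (C \ anc G D)) C D z → z ∉ D → z ∉ anc G D →
      ActiveTo (removeIncoming G (C \ anc G D)) C D b := by
    have step : ∀ z w, G.Adj z w → ActiveTo (removeIncoming G (C \ anc G D)) C D z → z ∉ D →
        ActiveTo (removeIncoming G (C \ anc G D)) C D w := by
      intro z w hzw hz hzD
      by_cases hw : w ∈ C \ anc G D
      · exact (openTo_of_mem hw.1).activeTo
      · exact hz.child hK hzD ⟨hzw, hw⟩
    intro z b hzb
    induction hzb using Relation.TransGen.head_induction_on with
    | single h => exact fun hz hzD _ => step _ _ h hz hzD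
    | head h _ ih =>
      exact fun hz hzD hzA => ih (step _ _ h hz hzD) (fun hd => hzA (mem_anc_of_adj h (.inl hd)))
        (fun hd => hzA (mem_anc_of_adj h (.inr hd)))
  have hcD : c ∉ D := Set.disjoint_left.1 hCD hc.1
  rintro ((hB | hD) | ⟨d, hd | hd, hcd⟩)
  · exact Set.disjoint_left.1 hBC hB hc.1
  · exact hcD hD
  · exact h.not_activeTo hd (key c d hcd (openTo_of_mem hc.1).activeTo hcD hc.2)
  · exact hc.2 ⟨d, hd, hcd⟩

end Subgraph

/-! ### Integrating products of functions of few coordinates -/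

section Integration

variable {V : Type*} [DecidableEq V] {𝒳 : V → Type*} [∀ v, MeasurableSpace (𝒳 v)]
  {μ : ∀ v, Measure (𝒳 v)} {s t : Finset V} {f g : (∀ v, 𝒳 v) → ℝ≥0∞}

theorem lmarginal_mul_left (hg : Measurable g) (hf : DependsOn f (t : Set V)ᶜ) :
    lmarginal μ t (fun x => f x * g x) = fun x => f x * lmarginal μ t g x := by
  ext x
  have : ∀ y : ∀ i : t, 𝒳 i, f (Function.updateFinset x t y) = f x := fun y =>
    hf fun i hi => by
      simp only [Set.mem_compl_iff, Finset.mem_coe] at hi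
      simp [Function.updateFinset, hi]
  simp only [lmarginal, this]
  exact lintegral_const_mul _ (hg.comp measurable_updateFinset)

theorem lmarginal_dependsOn {u : Set V} (hg : DependsOn g u) : DependsOn (lmarginal μ t g) u := by
  intro x y hxy
  refine lintegral_congr fun z => hg fun i hi => ?_
  by_cases hit : i ∈ t <;> simp [Function.updateFinset, hit, hxy i hi]

variable [∀ v, SigmaFinite (μ v)]

theorem lmarginal_union_mul (hf : Measurable f) (hg : Measurable g) (hst : Disjoint s t)
    (hft : DependsOn f (t : Set V)ᶜ) (hgs : DependsOn g (s : Set V)ᶜ) :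
    lmarginal μ (s ∪ t) (fun x => f x * g x) =
      fun x => lmarginal μ s f x * lmarginal μ t g x := by
  rw [lmarginal_union μ (fun x => f x * g x) (hf.mul hg) hst, lmarginal_mul_left hg hft]
  simp_rw [mul_comm (f _)]
  rw [lmarginal_mul_left hf (lmarginal_dependsOn hgs)]
  simp_rw [mul_comm]

end Integration

/-! ### Densities that factorize according to a DAG -/

section Factorization

variable {V : Type*} {𝒳 : V → Type*}

theorem dependsOn_prod {q : V → (∀ v, 𝒳 v) → ℝ≥0∞} {s : Finset V} {u : Set V}
    (h : ∀ k ∈ s, DependsOn (q k) u) : DependsOn (fun x => ∏ k ∈ s, q k x) u :=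
  fun _ _ hxy => Finset.prod_congr rfl fun k hk => h k hk hxy

variable [DecidableEq V] [∀ v, MeasurableSpace (𝒳 v)]

/-- The functions `q k` are (measurable) conditional densities of the variables `x_k` given their
parents in `H`, each regarded as a function of the whole vector `x`. -/
structure IsMarkovFamily (H : Digraph V) (μ : ∀ v, Measure (𝒳 v))
    (q : V → (∀ v, 𝒳 v) → ℝ≥0∞) : Prop where
  measurable : ∀ k, Measurable (q k)
  dependsOn : ∀ k, DependsOn (q k) {j | j = k ∨ H.Adj j k}
  lintegral_eq_one : ∀ k x, ∫⁻ t, q k (Function.update x k t) ∂(μ k) = 1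

variable [Fintype V] {H : Digraph V} {μ : ∀ v, Measure (𝒳 v)} [∀ v, SigmaFinite (μ v)]
  {q : V → (∀ v, 𝒳 v) → ℝ≥0∞}

/-- The variables outside an ancestral set are integrated out one after the other, children before
their parents; each one occurs in a single remaining factor, whose integral is `1`. -/
theorem IsMarkovFamily.lmarginal_compl (hH : IsDAG H) (hq : IsMarkovFamily H μ q)
    (Z : Finset V) (hZ : ∀ k ∈ Z, ∀ j, H.Adj j k → j ∈ Z) :
    lmarginal μ Zᶜ (fun x => ∏ k, q k x) = fun x => ∏ k ∈ Z, q k x := by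
  induction hn : Zᶜ.card generalizing Z with
  | zero =>
    obtain rfl : Z = Finset.univ := by
      simpa using Finset.card_eq_zero.1 hn
    simp
  | succ n ih =>
    have hwf : WellFounded (Relation.TransGen H.Adj) :=
      haveI : Std.Irrefl (Relation.TransGen H.Adj) := ⟨hH⟩
      Finite.wellFounded_of_trans_of_irrefl _
    -- `v` has no parents outside `Z`
    obtain ⟨v, hv, hmin⟩ := hwf.has_min {v | v ∉ Z} (by
      obtain ⟨v, hv⟩ := Finset.card_pos.1 (by omega : 0 < Zᶜ.card)
      exact ⟨v, by simpa using hv⟩)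
    have hv : v ∉ Z := hv
    have hpa : ∀ j, H.Adj j v → j ∈ Z := fun j hj => by
      by_contra hjZ
      exact hmin j hjZ (.single hj)
    have hcompl : Zᶜ = {v} ∪ (insert v Z)ᶜ := by
      ext j
      by_cases hj : j = v <;> simp [hj, hv]
    have hdisj : Disjoint {v} (insert v Z)ᶜ := by simp
    have hm : Measurable fun x => ∏ k, q k x :=
      Finset.measurable_prod _ fun k _ => hq.measurable k
    have hcard : (insert v Z)ᶜ.card = n := by
      rw [hcompl, Finset.card_union_of_disjoint hdisj] at hn
      simp at hn ⊢; omega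
    rw [hcompl, lmarginal_union μ _ hm hdisj, ih (insert v Z) ?_ hcard]
    · simp_rw [Finset.prod_insert hv, mul_comm (q v _)]
      rw [lmarginal_mul_left (hq.measurable v)]
      · simp [lmarginal_singleton, hq.lintegral_eq_one]
      · refine dependsOn_prod fun k hk => (hq.dependsOn k).mono ?_
        rintro j (rfl | hj) <;>
          simp only [Finset.coe_singleton, Set.mem_compl_iff, Set.mem_singleton_iff]
        · rintro rfl; exact hv hk
        · rintro rfl; exact hv (hZ k hk _ hj)
    · intro k hk j hj
      rcases Finset.mem_insert.1 hk with rfl | hk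
      · exact Finset.mem_insert_of_mem (hpa j hj)
      · exact Finset.mem_insert_of_mem (hZ k hk j hj)

theorem IsMarkovFamily.marginal_eq (hH : IsDAG H) (hq : IsMarkovFamily H μ q)
    {Z T : Finset V} (hZ : ∀ k ∈ Z, ∀ j, H.Adj j k → j ∈ Z) (hT : T ⊆ Z) :
    marginal μ (fun x => ∏ k, q k x) T = lmarginal μ (Z \ T) (fun x => ∏ k ∈ Z, q k x) := by
  have hcompl : Tᶜ = (Z \ T) ∪ Zᶜ := by
    ext j
    have := @hT j
    simp only [Finset.mem_compl, Finset.mem_union, Finset.mem_sdiff]; tauto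
  have hdisj : Disjoint (Z \ T) Zᶜ :=
    disjoint_compl_right.mono_left Finset.sdiff_subset
  ext x
  rw [marginal, hcompl,
    lmarginal_union μ _ (Finset.measurable_prod _ fun k _ => hq.measurable k) hdisj,
    hq.lmarginal_compl hH Z hZ]

open Classical in
/-- The indices `k ∈ Z` for which neither `k` nor any of its parents is in `R`. -/
noncomputable def familiesAvoiding (H : Digraph V) (Z R : Finset V) : Finset V :=
  Z.filter fun k => ∀ j, j = k ∨ H.Adj j k → j ∉ R

theorem mem_familiesAvoiding {Z R : Finset V} {k : V} :
    k ∈ familiesAvoiding H Z R ↔ k ∈ Z ∧ ∀ j, j = k ∨ H.Adj j k → j ∉ R := by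
  simp [familiesAvoiding]

/-- If the families (nodes with their parents) of an ancestral set `Z` that meet `R` are contained
in `R ∪ D`, every marginal of a set between `D` and `Z` is the product of an integral over
coordinates outside `R` and one over coordinates in `R`. -/
theorem IsMarkovFamily.marginal_eq_mul (hH : IsDAG H) (hq : IsMarkovFamily H μ q)
    {Z R D T : Finset V} (hZ : ∀ k ∈ Z, ∀ j, H.Adj j k → j ∈ Z) (hR : R ⊆ Z)
    (hfam : ∀ k ∈ Z, ∀ z w, (z = k ∨ H.Adj z k) → (w = k ∨ H.Adj w k) → w ∉ D → z ∈ R → w ∈ R)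
    (hDT : D ⊆ T) (hT : T ⊆ Z) (x : ∀ v, 𝒳 v) :
    marginal μ (fun x => ∏ k, q k x) T x =
      lmarginal μ ((Z \ R) \ T) (fun x => ∏ k ∈ familiesAvoiding H Z R, q k x) x *
      lmarginal μ (R \ T) (fun x => ∏ k ∈ Z \ familiesAvoiding H Z R, q k x) x := by
  have hsub : familiesAvoiding H Z R ⊆ Z := fun k hk => (mem_familiesAvoiding.1 hk).1
  have hset : Z \ T = ((Z \ R) \ T) ∪ (R \ T) := by
    ext j
    have := @hR j
    simp only [Finset.mem_union, Finset.mem_sdiff]; tauto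
  have hprod : (fun x => ∏ k ∈ Z, q k x) = fun x => (∏ k ∈ familiesAvoiding H Z R, q k x) *
      ∏ k ∈ Z \ familiesAvoiding H Z R, q k x := by
    ext x
    rw [mul_comm, Finset.prod_sdiff hsub]
  rw [hq.marginal_eq hH hZ hT, hset, hprod, lmarginal_union_mul
    (Finset.measurable_prod _ fun k _ => hq.measurable k)
    (Finset.measurable_prod _ fun k _ => hq.measurable k)]
  · exact (Finset.disjoint_sdiff.mono_right Finset.sdiff_subset).symm.mono_right
      Finset.sdiff_subset
  · refine dependsOn_prod fun k hk => (hq.dependsOn k).mono fun j hj hjR => ?_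
    exact (mem_familiesAvoiding.1 hk).2 j hj (Finset.mem_sdiff.1 hjR).1
  · refine dependsOn_prod fun k hk => (hq.dependsOn k).mono fun j hj hjR => ?_
    simp only [Finset.mem_sdiff, mem_familiesAvoiding, not_and, not_forall,
      not_not] at hk
    obtain ⟨z, hz, hzR⟩ := hk.2 hk.1
    simp only [Finset.coe_sdiff, Set.mem_sdiff, Finset.mem_coe] at hjR
    exact hjR.1.2 (hfam k hk.1 z j hz hj (fun hD => hjR.2 (hDT hD)) hzR)

/-- Cancellation in a quotient whose denominator is neither zero nor infinite;
`a` may be infinite. -/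
theorem ennreal_mul_div_mul_right {a b c : ℝ≥0∞} (h0 : b * c ≠ 0) (hT : b * c ≠ ∞) :
    a * c / (b * c) = a / b := by
  have hb : b ≠ 0 := left_ne_zero_of_mul h0
  exact ENNReal.mul_div_mul_right a b (right_ne_zero_of_mul h0)
    fun hc => hT (by rw [hc, ENNReal.mul_top hb])

/-- The conditional density of `x_B` given `x_{C ∪ D}`, when `C ⊆ R` and `B` avoids `R`, involves
only the factors whose families avoid `R`. -/
theorem IsMarkovFamily.cond_eq (hH : IsDAG H) (hq : IsMarkovFamily H μ q)
    {Z R B C D : Finset V} (hZ : ∀ k ∈ Z, ∀ j, H.Adj j k → j ∈ Z) (hR : R ⊆ Z)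
    (hfam : ∀ k ∈ Z, ∀ z w, (z = k ∨ H.Adj z k) → (w = k ∨ H.Adj w k) → w ∉ D → z ∈ R → w ∈ R)
    (hB : B ⊆ Z) (hC : C ⊆ R) (hD : D ⊆ Z) (hBR : Disjoint B R) (x : ∀ v, 𝒳 v)
    (h0 : marginal μ (fun x => ∏ k, q k x) (C ∪ D) x ≠ 0)
    (hT : marginal μ (fun x => ∏ k, q k x) (C ∪ D) x ≠ ∞) :
    marginal μ (fun x => ∏ k, q k x) (B ∪ (C ∪ D)) x /
        marginal μ (fun x => ∏ k, q k x) (C ∪ D) x =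
      lmarginal μ ((Z \ R) \ (B ∪ D)) (fun x => ∏ k ∈ familiesAvoiding H Z R, q k x) x /
      lmarginal μ ((Z \ R) \ D) (fun x => ∏ k ∈ familiesAvoiding H Z R, q k x) x := by
  have hCD : C ∪ D ⊆ Z := Finset.union_subset (hC.trans hR) hD
  have h1 := hq.marginal_eq_mul hH hZ hR hfam (T := C ∪ D) Finset.subset_union_right hCD x
  have h2 := hq.marginal_eq_mul hH hZ hR hfam (T := B ∪ (C ∪ D))
    (Finset.subset_union_right.trans Finset.subset_union_right) (Finset.union_subset hB hCD) x
  have e1 : (Z \ R) \ (C ∪ D) = (Z \ R) \ D := by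
    ext j
    have := @hC j
    simp only [Finset.mem_union, Finset.mem_sdiff]; tauto
  have e2 : (Z \ R) \ (B ∪ (C ∪ D)) = (Z \ R) \ (B ∪ D) := by
    ext j
    have := @hC j
    simp only [Finset.mem_union, Finset.mem_sdiff]; tauto
  have e3 : R \ (B ∪ (C ∪ D)) = R \ (C ∪ D) := by
    ext j
    have : j ∈ R → j ∉ B := fun h => Finset.disjoint_right.1 hBR h
    simp only [Finset.mem_union, Finset.mem_sdiff]; tauto
  rw [e1] at h1
  rw [e2, e3] at h2
  rw [h1] at h0 hT
  rw [h1, h2, ennreal_mul_div_mul_right h0 hT]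

end Factorization

/-! ### Ancestral closures and the separating set -/

section Separation

variable {V : Type*} {H K : Digraph V} {B C D : Finset V}

open Classical in
/-- The nodes of `S` and their ancestors. -/
noncomputable def ancestralClosure [Fintype V] (H : Digraph V) (S : Set V) : Finset V :=
  Finset.univ.filter fun v => v ∈ S ∨ v ∈ anc H S

theorem mem_ancestralClosure [Fintype V] {S : Set V} {v : V} :
    v ∈ ancestralClosure H S ↔ v ∈ S ∨ v ∈ anc H S := by
  simp [ancestralClosure]

theorem ancestralClosure_ancestral [Fintype V] {S : Set V} :
    ∀ k ∈ ancestralClosure H S, ∀ j, H.Adj j k → j ∈ ancestralClosure H S :=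
  fun _ hk _ hj => mem_ancestralClosure.2 (.inr (mem_anc_of_adj hj (mem_ancestralClosure.1 hk)))

/-- Graphical content of d-separation: the nodes outside `D` with an active path to `C` form a set
that contains `C`, avoids `B`, and together with `D` contains every family that it meets. -/
theorem DSep.exists_separating (hK : IsDAG K) (h : DSep K (B : Set V) C D) {Z : Finset V}
    (hZ : ∀ k ∈ Z, k ∈ (B ∪ C ∪ D : Set V) ∨ k ∈ anc K (B ∪ C ∪ D : Set V))
    (hpa : ∀ k ∈ Z, ∀ j, K.Adj j k → j ∈ Z) (hCZ : C ⊆ Z) (hCD : Disjoint C D) :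
    ∃ R ⊆ Z, C ⊆ R ∧ Disjoint B R ∧ ∀ k ∈ Z, ∀ z w, (z = k ∨ K.Adj z k) →
      (w = k ∨ K.Adj w k) → w ∉ D → z ∈ R → w ∈ R := by
  classical
  refine ⟨Z.filter fun v => v ∉ D ∧ ActiveTo K C D v, Finset.filter_subset _ _, ?_, ?_, ?_⟩
  · intro c hc
    exact Finset.mem_filter.2 ⟨hCZ hc, Finset.disjoint_left.1 hCD hc, (openTo_of_mem hc).activeTo⟩
  · refine Finset.disjoint_left.2 fun b hb hbR => ?_
    exact h.not_activeTo hb (Finset.mem_filter.1 hbR).2.2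
  · intro k hk z w hz hw hwD hzR
    obtain ⟨-, hzD, hzC⟩ := Finset.mem_filter.1 hzR
    refine Finset.mem_filter.2 ⟨?_, hwD, h.activeTo_of_family hK (hZ k hk) hz hw hzD hwD hzC⟩
    rcases hw with rfl | hw
    exacts [hk, hpa k hk w hw]

end Separation

/-! ### Conditional densities under d-separation -/

section Markov

variable {V : Type*} [Fintype V] [DecidableEq V] {𝒳 : V → Type*} [∀ v, MeasurableSpace (𝒳 v)]
  {H : Digraph V} {μ : ∀ v, Measure (𝒳 v)} [∀ v, SigmaFinite (μ v)]
  {q q' : V → (∀ v, 𝒳 v) → ℝ≥0∞} {B C D : Finset V}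

/-- The global Markov property, for densities evaluated at a point. -/
theorem IsMarkovFamily.cond_eq_of_dSep (hH : IsDAG H) (hq : IsMarkovFamily H μ q)
    (hCD : Disjoint C D) (h : DSep H (B : Set V) C D) (x : ∀ v, 𝒳 v)
    (h0 : marginal μ (fun x => ∏ k, q k x) (C ∪ D) x ≠ 0)
    (hT : marginal μ (fun x => ∏ k, q k x) (C ∪ D) x ≠ ∞)
    (h0' : marginal μ (fun x => ∏ k, q k x) D x ≠ 0)
    (hT' : marginal μ (fun x => ∏ k, q k x) D x ≠ ∞) :
    marginal μ (fun x => ∏ k, q k x) (B ∪ (C ∪ D)) x /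
        marginal μ (fun x => ∏ k, q k x) (C ∪ D) x =
      marginal μ (fun x => ∏ k, q k x) (B ∪ D) x / marginal μ (fun x => ∏ k, q k x) D x := by
  set Z := ancestralClosure H (B ∪ C ∪ D : Set V)
  have hBZ : B ⊆ Z := fun b hb => mem_ancestralClosure.2 (.inl (by simp [hb]))
  have hCZ : C ⊆ Z := fun b hb => mem_ancestralClosure.2 (.inl (by simp [hb]))
  have hDZ : D ⊆ Z := fun b hb => mem_ancestralClosure.2 (.inl (by simp [hb]))
  obtain ⟨R, hRZ, hCR, hBR, hfam⟩ := h.exists_separating hH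
    (fun k hk => mem_ancestralClosure.1 hk) ancestralClosure_ancestral hCZ hCD
  have e1 := hq.cond_eq hH ancestralClosure_ancestral hRZ hfam hBZ hCR hDZ hBR x h0 hT
  have e2 := hq.cond_eq hH ancestralClosure_ancestral hRZ hfam hBZ (Finset.empty_subset R) hDZ hBR x
    (by simpa using h0') (by simpa using hT')
  rw [Finset.empty_union] at e2
  rw [e1, e2]

/-- Changing the factors of the children of `C` does not affect the conditional density of `x_B`
given `x_D`. Within the ancestral closure of `B ∪ D`, all nodes of `C` are ancestors of `D`, so that
no arrows are missing from the graph of the hypothesis, and the changed factors are on the far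
side of the separation. -/
theorem IsMarkovFamily.cond_congr_of_dSep (hH : IsDAG H) (hq : IsMarkovFamily H μ q)
    (hq' : IsMarkovFamily H μ q') (hqq' : ∀ k, (∀ j ∈ C, ¬ H.Adj j k) → q k = q' k)
    (hBC : Disjoint B C) (hCD : Disjoint C D)
    (h : DSep (removeIncoming H (C \ anc H D)) (B : Set V) C D) (x : ∀ v, 𝒳 v)
    (h0 : marginal μ (fun x => ∏ k, q k x) D x ≠ 0)
    (hT : marginal μ (fun x => ∏ k, q k x) D x ≠ ∞)
    (h0' : marginal μ (fun x => ∏ k, q' k x) D x ≠ 0)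
    (hT' : marginal μ (fun x => ∏ k, q' k x) D x ≠ ∞) :
    marginal μ (fun x => ∏ k, q k x) (B ∪ D) x / marginal μ (fun x => ∏ k, q k x) D x =
      marginal μ (fun x => ∏ k, q' k x) (B ∪ D) x / marginal μ (fun x => ∏ k, q' k x) D x := by
  set K := removeIncoming H (C \ anc H D)
  have hK : IsDAG K := hH.mono fun _ _ h => h.1
  set Z := ancestralClosure H (B ∪ D : Set V)
  have hBZ : B ⊆ Z := fun b hb => mem_ancestralClosure.2 (.inl (by simp [hb]))
  have hDZ : D ⊆ Z := fun b hb => mem_ancestralClosure.2 (.inl (by simp [hb]))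
  have hZI : ∀ k ∈ Z, k ∉ (C : Set V) \ anc H D := fun k hk hkI =>
    h.notMem_ancestral hH (by simpa using hBC) (by simpa using hCD) hkI (mem_ancestralClosure.1 hk)
  have hZpa : ∀ k ∈ Z, ∀ j, H.Adj j k → j ∈ Z := ancestralClosure_ancestral
  have hKpa : ∀ k ∈ Z, ∀ j, H.Adj j k → K.Adj j k := fun k hk j hj => ⟨hj, hZI k hk⟩
  have hpath : ∀ k d, Relation.TransGen H.Adj k d → d ∈ (B ∪ D : Set V) →
      Relation.TransGen K.Adj k d := by
    intro k d hkd hd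
    have hdZ : d ∈ Z := mem_ancestralClosure.2 (.inl hd)
    induction hkd using Relation.TransGen.head_induction_on with
    | single hj => exact .single (hKpa _ hdZ _ hj)
    | head hj hcd ih => exact .head (hKpa _ (mem_ancestralClosure.2 (.inr ⟨d, hd, hcd⟩)) _ hj) ih
  have hsep : DSep K (B : Set V) (C ∩ Z : Finset V) D := fun p hp hb ⟨c, hc, hl⟩ =>
    h p hp hb ⟨c, (Finset.mem_inter.1 hc).1, hl⟩
  have hZK : ∀ k ∈ Z, k ∈ (B ∪ (C ∩ Z : Finset V) ∪ D : Set V) ∨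
      k ∈ anc K (B ∪ (C ∩ Z : Finset V) ∪ D : Set V) := by
    have hsub : (B ∪ D : Set V) ⊆ B ∪ (C ∩ Z : Finset V) ∪ D :=
      Set.union_subset_union_left _ Set.subset_union_left
    intro k hk
    rcases mem_ancestralClosure.1 hk with hk | ⟨d, hd, hkd⟩
    · exact .inl (hsub hk)
    · exact .inr ⟨d, hsub hd, hpath k d hkd hd⟩
  obtain ⟨R, hRZ, hCR, hBR, hfam⟩ := hsep.exists_separating hK hZK
    (fun k hk j hj => hZpa k hk j hj.1) Finset.inter_subset_right
    (hCD.mono_left Finset.inter_subset_left)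
  have hfamH : ∀ k ∈ Z, ∀ z w, (z = k ∨ H.Adj z k) → (w = k ∨ H.Adj w k) → w ∉ D → z ∈ R →
      w ∈ R := fun k hk z w hz hw =>
    hfam k hk z w (hz.imp_right (hKpa k hk z)) (hw.imp_right (hKpa k hk w))
  have hprod : (fun x => ∏ k ∈ familiesAvoiding H Z R, q k x) =
      fun x => ∏ k ∈ familiesAvoiding H Z R, q' k x := by
    ext x
    refine Finset.prod_congr rfl fun k hk => ?_
    obtain ⟨hkZ, hkR⟩ := mem_familiesAvoiding.1 hk
    rw [hqq' k fun j hjC hj =>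
      hkR j (.inr hj) (hCR (Finset.mem_inter.2 ⟨hjC, hZpa k hkZ j hj⟩))]
  have e1 := hq.cond_eq hH hZpa hRZ hfamH hBZ (Finset.empty_subset R) hDZ hBR x
    (by simpa using h0) (by simpa using hT)
  have e2 := hq'.cond_eq hH hZpa hRZ hfamH hBZ (Finset.empty_subset R) hDZ hBR x
    (by simpa using h0') (by simpa using hT')
  rw [Finset.empty_union] at e1 e2
  rw [e1, e2, hprod]

end Markov

/-! ### Info-interventions -/

namespace InfoCausalDAG

variable {V : Type*} [Fintype V] [DecidableEq V] {𝒳 : V → Type*} [∀ v, MeasurableSpace (𝒳 v)]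
  {G : Digraph V} {μ : ∀ v, Measure (𝒳 v)} [∀ v, SigmaFinite (μ v)] {P : Measure (∀ v, 𝒳 v)}

/-- The factor `P(x_k | x*_{pa(k)})` of the density of the info-intervention distribution. -/
def infoFactor (M : InfoCausalDAG G μ P) (A : Finset V) (x' : ∀ v, 𝒳 v) (k : V)
    (x : ∀ v, 𝒳 v) : ℝ≥0∞ :=
  M.cond k (fun j => A.piecewise x' x j) (x k)

theorem infoFactor_congr (M : InfoCausalDAG G μ P) {A A' : Finset V} {x' x y : ∀ v, 𝒳 v} {k : V}
    (hpa : ∀ j, G.Adj j k → A.piecewise x' x j = A'.piecewise x' y j) (hk : x k = y k) :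
    M.infoFactor A x' k x = M.infoFactor A' x' k y := by
  have : (fun j : parents G k => A.piecewise x' x j) = fun j : parents G k => A'.piecewise x' y j :=
    funext fun j => hpa j (by simpa [parents] using j.2)
  rw [infoFactor, infoFactor, this, hk]

/-- An intervention on more nodes than `A` still factorizes according to the graph for `A`. This
allows the interventions on `A` and on `A ∪ C` to be compared over one graph. -/
theorem isMarkovFamily_infoFactor (M : InfoCausalDAG G μ P) {A A' : Finset V} (hA : A ⊆ A')
    (x' : ∀ v, 𝒳 v) : IsMarkovFamily (removeOutgoing G A) μ (M.infoFactor A' x') where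
  measurable k := by
    have hpw : Measurable fun x : ∀ v, 𝒳 v => fun j : parents G k => A'.piecewise x' x j := by
      refine measurable_pi_lambda _ fun j => ?_
      by_cases hj : (j : V) ∈ A'
      · simp [Finset.piecewise, hj]
      · simpa [Finset.piecewise, hj] using measurable_pi_apply (j : V)
    exact (M.measurable_cond k).comp (hpw.prodMk (measurable_pi_apply k))
  dependsOn k x y hxy := by
    refine M.infoFactor_congr (fun j hj => ?_) (hxy k (.inl rfl))
    by_cases hjA : j ∈ A'
    · simp [hjA]
    · simpa [hjA] using hxy j (.inr ⟨hj, fun h => hjA (hA h)⟩)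
  lintegral_eq_one k x := by
    refine (lintegral_congr fun t => ?_).trans
      (M.lintegral_cond k fun j => A'.piecewise x' x j)
    have : (fun j : parents G k => A'.piecewise x' (Function.update x k t) j) =
        fun j : parents G k => A'.piecewise x' x j := by
      funext j
      have hjk : (j : V) ≠ k := M.isDAG.ne (by simpa [parents] using j.2)
      simp [Finset.piecewise, hjk]
    rw [infoFactor, this, Function.update_self]

theorem infoProb_congr (M : InfoCausalDAG G μ P) (A : Finset V) {x' x y : ∀ v, 𝒳 v} {T : Finset V}
    (h : ∀ i ∈ T, x i = y i) : M.infoProb A x' T x = M.infoProb A x' T y :=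
  lmarginal_congr μ _ fun i hi => h i (by simpa using hi)

/-- Intervening on `C` and observing the intervened values on `C` agree on marginals of sets that
contain `C`. -/
theorem infoProb_union_eq (M : InfoCausalDAG G μ P) (A : Finset V) {C T : Finset V} (hCT : C ⊆ T)
    {x' x : ∀ v, 𝒳 v} (hx : ∀ c ∈ C, x c = x' c) :
    M.infoProb (A ∪ C) x' T x = M.infoProb A x' T x := by
  refine lintegral_congr fun y => Finset.prod_congr rfl fun k _ => ?_
  refine M.infoFactor_congr (fun j _ => ?_) rfl
  by_cases hA : j ∈ A
  · simp [hA]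
  · by_cases hC : j ∈ C
    · have := hCT hC
      simp [hA, hC, Function.updateFinset, this, hx j hC]
    · simp [hA, hC]

end InfoCausalDAG

end InfoCalculus

theorem mainTheorem1 {V : Type*} [Fintype V] [DecidableEq V] {𝒳 : V → Type*}
    [∀ v, MeasurableSpace (𝒳 v)] (μ : ∀ v, Measure (𝒳 v)) [∀ v, SigmaFinite (μ v)]
    (G : Digraph V) (P : Measure (∀ v, 𝒳 v)) [IsProbabilityMeasure P]
    (M : InfoCalculus.InfoCausalDAG G μ P) (A B C D : Finset V)
    (hAB : Disjoint A B) (hAC : Disjoint A C) (hAD : Disjoint A D)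
    (hBC : Disjoint B C) (hBD : Disjoint B D) (hCD : Disjoint C D) (x' x : ∀ v, 𝒳 v) :
    -- Rule 1: insertion/deletion of observations
    (InfoCalculus.DSep (InfoCalculus.removeOutgoing G A) B C D →
      M.InfoCondDefined A x' (C ∪ D) x → M.InfoCondDefined A x' D x →
      M.infoCond A x' B (C ∪ D) x = M.infoCond A x' B D x) ∧
    -- Rule 2: action/observation exchange; `C.piecewise x' x` observes the value `x'` on `C`
    (InfoCalculus.DSep (InfoCalculus.removeOutgoing G (A ∪ C)) B C D →
      M.InfoCondDefined (A ∪ C) x' D x → M.InfoCondDefined A x' (C ∪ D) (C.piecewise x' x) →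
      M.infoCond (A ∪ C) x' B D x = M.infoCond A x' B (C ∪ D) (C.piecewise x' x)) ∧
    -- Rule 3: insertion/deletion of actions, with the ancestors of `D` taken in `G`
    (InfoCalculus.DSep (InfoCalculus.removeIncoming (InfoCalculus.removeOutgoing G A)
        (C \ InfoCalculus.anc G D)) B C D →
      M.InfoCondDefined (A ∪ C) x' D x → M.InfoCondDefined A x' D x →
      M.infoCond (A ∪ C) x' B D x = M.infoCond A x' B D x) ∧
    -- Rule 3, with the ancestors of `D` taken in the info-intervention DAG
    (InfoCalculus.DSep (InfoCalculus.removeIncoming (InfoCalculus.removeOutgoing G A)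
        (C \ InfoCalculus.anc (InfoCalculus.removeOutgoing G A) D)) B C D →
      M.InfoCondDefined (A ∪ C) x' D x → M.InfoCondDefined A x' D x →
      M.infoCond (A ∪ C) x' B D x = M.infoCond A x' B D x) := by
  have hdag : ∀ A : Set V, InfoCalculus.IsDAG (InfoCalculus.removeOutgoing G A) :=
    fun _ => M.isDAG.mono fun _ _ h => h.1
  have rule1 : ∀ (A : Finset V) (x : ∀ v, 𝒳 v),
      InfoCalculus.DSep (InfoCalculus.removeOutgoing G A) B C D →
      M.InfoCondDefined A x' (C ∪ D) x → M.InfoCondDefined A x' D x →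
      M.infoCond A x' B (C ∪ D) x = M.infoCond A x' B D x := fun A x h h1 h2 =>
    (M.isMarkovFamily_infoFactor subset_rfl x').cond_eq_of_dSep (hdag A) hCD h x h1.1 h1.2 h2.1 h2.2
  have rule3 : InfoCalculus.DSep (InfoCalculus.removeIncoming (InfoCalculus.removeOutgoing G A)
        (C \ InfoCalculus.anc (InfoCalculus.removeOutgoing G A) D)) B C D →
      M.InfoCondDefined (A ∪ C) x' D x → M.InfoCondDefined A x' D x →
      M.infoCond (A ∪ C) x' B D x = M.infoCond A x' B D x := fun h h1 h2 => by
    refine (M.isMarkovFamily_infoFactor Finset.subset_union_left x').cond_congr_of_dSep (hdag A)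
      (M.isMarkovFamily_infoFactor subset_rfl x') (fun k hk => funext fun y => ?_)
      hBC hCD h x h1.1 h1.2 h2.1 h2.2
    refine M.infoFactor_congr (fun j hj => ?_) rfl
    by_cases hA : j ∈ A
    · simp [hA]
    · have hC : j ∉ C := fun hC => hk j hC ⟨hj, hA⟩
      simp [hA, hC]
  refine ⟨rule1 A x, fun h h1 h2 => ?_, fun h => rule3 (h.mono ?_ ?_), rule3⟩
  · have hC : ∀ c ∈ C, C.piecewise x' x c = x' c := fun c hc => by simp [hc]
    have hx : ∀ T : Finset V, Disjoint C T →
        M.infoProb (A ∪ C) x' T x = M.infoProb (A ∪ C) x' T (C.piecewise x' x) := fun T hT =>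
      M.infoProb_congr _ fun i hi => by simp [Finset.disjoint_right.1 hT hi]
    have hT : ∀ T : Finset V, C ⊆ T → M.infoProb (A ∪ C) x' T (C.piecewise x' x) =
        M.infoProb A x' T (C.piecewise x' x) := fun T hT => M.infoProb_union_eq A hT hC
    have key := rule1 (A ∪ C) (C.piecewise x' x) (by simpa using h)
      (by rwa [InfoCalculus.InfoCausalDAG.InfoCondDefined, hT _ Finset.subset_union_left])
      (by rwa [InfoCalculus.InfoCausalDAG.InfoCondDefined, ← hx _ hCD])
    simp only [InfoCalculus.InfoCausalDAG.infoCond] at key ⊢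
    rw [hx _ hCD, hx _ (Finset.disjoint_union_right.2 ⟨hBC.symm, hCD⟩), ← key,
      hT _ Finset.subset_union_left,
      hT _ (Finset.subset_union_left.trans Finset.subset_union_right)]
  · exact (hdag A).mono fun _ _ h => h.1
  -- fewer nodes are ancestors of `D` in the smaller graph, so more arrows are removed
  · exact fun i j hij => ⟨hij.1, fun hj => hij.2 ⟨hj.1, fun hj' =>
      hj.2
      (InfoCalculus.anc_mono (H := InfoCalculus.removeOutgoing G A) (fun _ _ h => h.1) hj')⟩⟩
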